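/- **Theorem 6.1 ($\Sigma$-compactness).** *Setting.* An *$\mathbb R$-group* is a set $E\subset\mathbb R$ containing all positive integers, with an abelian group law on $E$ (written multiplicatively, with identity $e$; it need not be the multiplication of real numbers), such that: $E$ with the order of $\mathbb R$ is a totally ordered group; $E$ with the topology induced by $\mathbb R$ is a locally compact group; and there is a nonconstant continuous homomorphism $h:E\to(0,\infty)$ such that for each $\alpha\in E$ the set $\{\varepsilon\in E:\varepsilon\ge\alpha\}$ has finite measure for $h\cdot m$, where $m$ is Haar measure on $E$. Put $\theta=\inf E\in[-\infty,+\infty]$. A *homogenizer* is a triple $(X,\mathcal H,\lambda)$ where - $X$ is a noncompact, locally compact Hausdorff space in which each point has a countable base of neighbourhoods; - $\mathcal H=(H_\varepsilon)_{\varepsilon\in E}$ is an action of an $\mathbb R$-group $E$ on $X$ such that $(\varepsilon,x)\mapsto H_\varepsilon(x)$ is continuous on $E\times X$, and which is absorptive: there is a point $\omega\in X$ (necessarily unique, called the center) such that for every neighbourhood $V$ of $\omega$ and every $x\in X$ there are a neighbourhood $U$ of $x$ and $\alpha\in E$ with $H_{\varepsilon^{-1}}(U)\subset V$ for all $\varepsilon\in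 E$, $\varepsilon\le\alpha$; - $\lambda$ is a positive Radon measure on $X$, $\lambda\ne0$, $\lambda\neq\delta_\omega$, such that for each $\varepsilon\in E$ there is a constant $c(\varepsilon)>0$ with $H_\varepsilon(\lambda)=c(\varepsilon)\lambda$, where $H_\varepsilon(\lambda)$ is the image measure. Let $\mathcal B(X)$ be the algebra of bounded continuous functions $X\to\mathbb C$ with the supremum norm. Let $\Pi^\infty$ be the set of all $u\in\mathcal B(X)$ for which there is a (unique) constant $M(u)\in\mathbb C$, called the mean value of $u$, such that $u\circ H_\varepsilon\to M(u)$ in $L^\infty(X,\lambda)$ weak-$*$ as $\varepsilon\to\theta$. A *homogenization algebra* on $(X,\mathcal H,\lambda)$ is a closed subalgebra $A$ of $\mathcal B(X)$ that is separable, contains the constants, is stable under complex conjugation and satisfies $A\subset\Pi^\infty$. Its spectrum $\Delta(A)$ (the nonzero multiplicative linear forms on $A$, with the weak-$*$ topology) is a compact metrizable space, and it carries the unique Radon measure $\beta$ such that $M(u)=\int_{\Delta(A)} s(u)\,d\beta(s)$ for all $u\in A$. Let $(X,\mathcal H,\lambda)$ be a homogenizer, $A$ a homogenization algebra on it, and $\Omega\subset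 X$ a nonempty open set with the measure induced by $\lambda$. A *fundamental sequence* is a sequence $S=(\varepsilon_n)_{n\in\mathbb N}$ in $E$ with $\varepsilon_n\le e$ for all $n$ and $\varepsilon_n\to\theta$. For $1\le p<\infty$ and $\frac1{p'}=1-\frac1p$, a sequence $(u_\varepsilon)_{\varepsilon\in S}$ in $L^p(\Omega)$ is said to *weakly $\Sigma$-converge* in $L^p(\Omega)$ to $u_0\in L^p(\Omega\times\Delta(A))$ (for the product measure $\lambda|_\Omega\otimes\beta$) if, as $S\ni\varepsilon\to\theta$, $$\int_\Omega u_\varepsilon(x)\,\psi(x)\big(H_\varepsilon(x)\big)\,d\lambda(x)\ \longrightarrow\ \iint_{\Omega\times\Delta(A)}u_0(x,s)\,s\big(\psi(x)\big)\,d\lambda(x)\,d\beta(s)\qquad\text{for all }\psi\in L^{p'}(\Omega;A).$$ *Theorem.* Assume that $1<p<\infty$ and that $X$ is metrizable. Let $S=(\varepsilon_n)_{n\in\mathbb N}$ be a fundamental sequence and let the sequence $(u_\varepsilon)_{\varepsilon\in S}$ be bounded in $L^p(\Omega)$. Then there are a subsequence $S'$ of $S$ and a function $u_0\in L^p(\Omega\times\Delta(A))$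 such that $(u_\varepsilon)_{\varepsilon\in S'}$ weakly $\Sigma$-converges in $L^p(\Omega)$ to $u_0$. -/

import Mathlib

open MeasureTheory Filter Topology Set
open scoped ENNReal BoundedContinuousFunction

noncomputable section

namespace SigmaConvergence

/-- An `ℝ`-group: a set `E` of real numbers containing all positive integers, with an abelian group
law on `E` (written multiplicatively, and unrelated to the multiplication of `ℝ` in general), such
that `E` is an ordered group for the order of `ℝ`, a locally compact topological group for the
topology of `ℝ`, and there is a nonconstant continuous homomorphism `h` from `E` to the
multiplicative group of positive reals for which each `{ε ∈ E : ε ≥ α}` has finite measure for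
`h · m`, where `m` is Haar measure on `E`. -/
structure IsRGroup (E : Set ℝ) [CommGroup E] : Prop where
  natCast_mem : ∀ n : ℕ, 0 < n → (n : ℝ) ∈ E
  ordered : IsOrderedMonoid E
  topologicalGroup : IsTopologicalGroup E
  locallyCompact : LocallyCompactSpace E
  exists_hom : ∃ h : E →* ℝ, (∀ ε, 0 < h ε) ∧ Continuous h ∧ (∃ ε, h ε ≠ 1) ∧
    ∃ m : Measure E, m.IsHaarMeasure ∧
      ∀ α : E, m.withDensity (fun ε => ENNReal.ofReal (h ε)) (Ici α) < ∞

/-- The greatest lower bound `θ` of `E` in the extended real line. -/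
def theta (E : Set ℝ) : EReal := sInf ((fun x : ℝ => (x : EReal)) '' E)

/-- The filter `ε → θ` on `E`. -/
def toTheta (E : Set ℝ) : Filter E := comap (fun ε : E => ((ε : ℝ) : EReal)) (𝓝 (theta E))

/-- `ω` is a center of the action `H_ε x = ε • x`: for every neighbourhood `V` of `ω` and every
`x` there are a neighbourhood `U` of `x` and `α ∈ E` with `H_{ε⁻¹}(U) ⊆ V` for all `ε ≤ α`. -/
def IsCenter (E : Set ℝ) [CommGroup E] {X : Type*} [TopologicalSpace X] [MulAction E X]
    (ω : X) : Prop :=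
  ∀ V ∈ 𝓝 ω, ∀ x : X, ∃ U ∈ 𝓝 x, ∃ α : E, ∀ ε : E, ε ≤ α → (fun y : X => ε⁻¹ • y) '' U ⊆ V

/-- `(X, H, lam)` is a homogenizer, where `H_ε x = ε • x`: `X` is a (Hausdorff) noncompact locally
compact first countable space, `H` is an absorptive continuous action of an `ℝ`-group, and `lam` is
a nontrivial homogeneous positive Radon measure on `X`. -/
structure IsHomogenizer (E : Set ℝ) [CommGroup E] {X : Type*} [TopologicalSpace X]
    [MeasurableSpace X] [MulAction E X] (lam : Measure X) : Prop where
  rGroup : IsRGroup E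
  t2 : T2Space X
  locallyCompact : LocallyCompactSpace X
  noncompact : NoncompactSpace X
  firstCountable : FirstCountableTopology X
  continuous_action : ContinuousSMul E X
  absorptive : ∃ ω : X, IsCenter E ω
  regular : lam.Regular
  homogeneous : ∀ ε : E, ∃ c : ℝ, 0 < c ∧ lam.map (fun x => ε • x) = ENNReal.ofReal c • lam
  ne_zero : lam ≠ 0
  ne_dirac : ∀ ω : X, IsCenter E ω → lam ≠ Measure.dirac ω

section MeanValue

variable (E : Set ℝ) [CommGroup E] {X : Type*} [TopologicalSpace X] [MeasurableSpace X]
  [MulAction E X] (lam : Measure X)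

/-- `u ∘ H_ε → c` weakly-* in `L^∞(X)` as `ε → θ`, for a bounded continuous `u` and a constant
`c`. -/
def HasMeanValue (u : X →ᵇ ℂ) (c : ℂ) : Prop :=
  ∀ f : X → ℂ, Integrable f lam →
    Tendsto (fun ε : E => ∫ x, u (ε • x) * f x ∂lam) (toTheta E) (𝓝 (∫ x, c * f x ∂lam))

/-- The domain `Π^∞` of the mean value. -/
def meanDomain : Set (X →ᵇ ℂ) := {u | ∃ c, HasMeanValue E lam u c}

open Classical in
/-- The mean value `M` (set to `0` outside its domain). -/
def meanValue (u : X →ᵇ ℂ) : ℂ := if h : ∃ c, HasMeanValue E lam u c then h.choose else 0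

/-- `A` is a homogenization algebra: a closed subalgebra of the algebra of bounded continuous
complex functions that contains the constants and is stable under conjugation (both part of
`StarSubalgebra`), is separable, and is contained in the domain of the mean value. -/
structure IsHomogenizationAlgebra (A : StarSubalgebra ℂ (X →ᵇ ℂ)) : Prop where
  isClosed : IsClosed (A : Set (X →ᵇ ℂ))
  separable : TopologicalSpace.SeparableSpace A
  subset_domain : (A : Set (X →ᵇ ℂ)) ⊆ meanDomain E lam

end MeanValue

/-- The spectrum `Δ(A)`: the nonzero multiplicative linear forms on `A`, with the weak-*
topology. -/
abbrev Spec {X : Type*} [TopologicalSpace X] (A : StarSubalgebra ℂ (X →ᵇ ℂ)) : Type _ :=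
  WeakDual.characterSpace ℂ A

/-- `Δ(A)` carries its Borel sets. -/
instance instMeasurableSpaceSpec {X : Type*} [TopologicalSpace X]
    (A : StarSubalgebra ℂ (X →ᵇ ℂ)) : MeasurableSpace (Spec A) := borel _

instance instBorelSpaceSpec {X : Type*} [TopologicalSpace X]
    (A : StarSubalgebra ℂ (X →ᵇ ℂ)) : BorelSpace (Spec A) := ⟨rfl⟩

section MMeasure

variable {E : Set ℝ} [CommGroup E] {X : Type*} [TopologicalSpace X] [MeasurableSpace X]
  [BorelSpace X] [MulAction E X] {lam : Measure X} {A : StarSubalgebra ℂ (X →ᵇ ℂ)}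

/-- `β` is a positive Radon measure on `Δ(A)` with `M(u) = ∫ s(u) dβ(s)` for all `u ∈ A`. -/
def IsMMeasure (E : Set ℝ) [CommGroup E] {X : Type*} [TopologicalSpace X] [MeasurableSpace X]
    [MulAction E X] (lam : Measure X) (A : StarSubalgebra ℂ (X →ᵇ ℂ))
    (β : Measure (Spec A)) : Prop :=
  β.Regular ∧ ∀ u : A, meanValue E lam (u : X →ᵇ ℂ) = ∫ s : Spec A, s u ∂β

theorem toTheta_neBot (hE : E.Nonempty) : (toTheta E).NeBot := by
  rw [toTheta, comap_neBot_iff]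
  intro t ht
  have h : theta E ∈ closure ((fun x : ℝ => (x : EReal)) '' E) :=
    (isGLB_sInf _).mem_closure (hE.image _)
  obtain ⟨y, hy, x, hx, rfl⟩ := mem_closure_iff_nhds.1 h t ht
  exact ⟨⟨x, hx⟩, hy⟩

theorem HasMeanValue.add {u v : X →ᵇ ℂ} {c d : ℂ} (hX : IsHomogenizer E lam)
    (hu : HasMeanValue E lam u c) (hv : HasMeanValue E lam v d) :
    HasMeanValue E lam (u + v) (c + d) := by
  have := hX.continuous_action
  have key : ∀ (w : X →ᵇ ℂ) (f : X → ℂ), Integrable f lam → ∀ ε : E,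
      Integrable (fun x => w (ε • x) * f x) lam := fun w f hf ε =>
    hf.bdd_mul (c := ‖w‖) (w.continuous.comp (continuous_const_smul ε)).aestronglyMeasurable
      (Eventually.of_forall fun x => w.norm_coe_le_norm _)
  intro f hf
  convert (hu f hf).add (hv f hf) using 2
  · rename_i ε
    rw [← integral_add (key u f hf ε) (key v f hf ε)]
    simp [add_mul]
  · rw [← integral_add (hf.const_mul c) (hf.const_mul d)]
    simp [add_mul]

theorem HasMeanValue.smul {u : X →ᵇ ℂ} {c : ℂ} (a : ℂ) (hu : HasMeanValue E lam u c) :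
    HasMeanValue E lam (a • u) (a * c) := by
  intro f hf
  convert (hu f hf).const_mul a using 2
  · rw [← integral_const_mul]; simp [mul_assoc]
  · rw [← integral_const_mul]; simp [mul_assoc]

/-- A nonnegative integrable function with integral `1`. -/
theorem exists_unit_integral (hX : IsHomogenizer E lam) :
    ∃ f : X → ℝ, (∀ x, 0 ≤ f x) ∧ Integrable f lam ∧ ∫ x, f x ∂lam = 1 := by
  have := hX.regular
  have := hX.t2
  have h0 : 0 < lam univ := by
    rw [pos_iff_ne_zero]; simpa using hX.ne_zero
  obtain ⟨K, -, hK, hpos⟩ := isOpen_univ.exists_lt_isCompact h0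
  have hfin : lam K ≠ ∞ := hK.measure_lt_top.ne
  have hr : 0 < lam.real K := ENNReal.toReal_pos hpos.ne' hfin
  refine ⟨K.indicator fun _ => (lam.real K)⁻¹, fun x => ?_, ?_, ?_⟩
  · exact indicator_nonneg (fun _ _ => by positivity) x
  · exact (integrable_indicator_iff hK.measurableSet).2 (by
      apply integrableOn_const hfin)
  · rw [integral_indicator_const _ hK.measurableSet]
    simp [hr.ne']

theorem HasMeanValue.unique {u : X →ᵇ ℂ} {c d : ℂ} (hX : IsHomogenizer E lam)
    (hu : HasMeanValue E lam u c) (hv : HasMeanValue E lam u d) : c = d := by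
  have := toTheta_neBot (E := E) ⟨_, hX.rGroup.natCast_mem 1 one_pos⟩
  obtain ⟨f, -, hf, h1⟩ := exists_unit_integral hX
  have := tendsto_nhds_unique (hu _ hf.ofReal) (hv _ hf.ofReal)
  have h1' : ∫ x, (f x : ℂ) ∂lam = 1 := by rw [integral_complex_ofReal, h1, Complex.ofReal_one]
  simpa [integral_const_mul, h1'] using! this

theorem HasMeanValue.meanValue_eq {u : X →ᵇ ℂ} {c : ℂ} (hX : IsHomogenizer E lam)
    (hu : HasMeanValue E lam u c) : meanValue E lam u = c := by
  have h : ∃ c, HasMeanValue E lam u c := ⟨c, hu⟩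
  rw [meanValue, dif_pos h]
  exact h.choose_spec.unique hX hu

theorem IsHomogenizationAlgebra.hasMeanValue (hX : IsHomogenizer E lam)
    (hA : IsHomogenizationAlgebra E lam A) (u : A) :
    HasMeanValue E lam (u : X →ᵇ ℂ) (meanValue E lam (u : X →ᵇ ℂ)) := by
  obtain ⟨c, hc⟩ := hA.subset_domain u.2
  rwa [hc.meanValue_eq hX]

/-- The mean value of a nonnegative function is nonnegative. -/
theorem HasMeanValue.nonneg {u : X →ᵇ ℂ} {c : ℂ} (hX : IsHomogenizer E lam)
    (hu : HasMeanValue E lam u c) (h : ∀ x, ∃ r : ℝ, 0 ≤ r ∧ u x = r) :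
    ∃ r : ℝ, 0 ≤ r ∧ c = r := by
  have := toTheta_neBot (E := E) ⟨_, hX.rGroup.natCast_mem 1 one_pos⟩
  obtain ⟨f, hf0, hf, h1⟩ := exists_unit_integral hX
  have ht := hu _ hf.ofReal
  have hc : ∫ x, c * (f x : ℂ) ∂lam = c := by
    rw [integral_const_mul, integral_complex_ofReal, h1, Complex.ofReal_one, mul_one]
  choose r hr0 hr using h
  have hcl : IsClosed {z : ℂ | ∃ r : ℝ, 0 ≤ r ∧ z = r} := by
    have : {z : ℂ | ∃ r : ℝ, 0 ≤ r ∧ z = r} = {z : ℂ | 0 ≤ z.re} ∩ {z : ℂ | z.im = 0} := by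
      ext z
      constructor
      · rintro ⟨r, h, rfl⟩; simpa using h
      · rintro ⟨h, h'⟩; exact ⟨z.re, h, Complex.ext (by simp) (by simpa using h')⟩
    rw [this]
    exact (isClosed_le continuous_const Complex.continuous_re).inter
      (isClosed_eq Complex.continuous_im continuous_const)
  have := hcl.mem_of_tendsto ht (Eventually.of_forall fun ε => ?_)
  · obtain ⟨r, h, h'⟩ := this
    exact ⟨r, h, hc.symm.trans h'⟩
  · refine ⟨∫ x, r (ε • x) * f x ∂lam, integral_nonneg fun x => mul_nonneg (hr0 _) (hf0 _), ?_⟩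
    rw [← integral_complex_ofReal]
    simp [hr]

theorem exists_isMMeasure_aux [IsClosed (A : Set (X →ᵇ ℂ))] (hX : IsHomogenizer E lam)
    (hA : IsHomogenizationAlgebra E lam A) :
    ∃ Λ : CompactlySupportedContinuousMap (Spec A) ℝ →ₚ[ℝ] ℝ, ∀ u : A,
      ∃ f g : CompactlySupportedContinuousMap (Spec A) ℝ,
        (∀ s : Spec A, s u = f s + Complex.I * g s) ∧
        meanValue E lam (u : X →ᵇ ℂ) = Λ f + Complex.I * Λ g := by
  let T : CompactlySupportedContinuousMap (Spec A) ℝ → C(Spec A, ℂ) := fun f =>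
    ⟨fun s => (f s : ℂ), Complex.continuous_ofReal.comp f.continuous⟩
  let R : CompactlySupportedContinuousMap (Spec A) ℝ → A := fun f =>
    (gelfandStarTransform A).symm (T f)
  have hR : ∀ f (s : Spec A), s (R f) = f s := fun f s => by
    have := congrArg (fun g : C(Spec A, ℂ) => g s) ((gelfandStarTransform A).apply_symm_apply (T f))
    simpa using! this
  have inj : ∀ u v : A, (∀ s : Spec A, s u = s v) → u = v := fun u v h =>
    (gelfandStarTransform A).injective (ContinuousMap.ext fun s => by simpa using! h s)
  have hM := fun u : A => hA.hasMeanValue hX u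
  have hnn : ∀ f : CompactlySupportedContinuousMap (Spec A) ℝ, (∀ s, 0 ≤ f s) →
      ∃ r : ℝ, 0 ≤ r ∧ meanValue E lam (R f : X →ᵇ ℂ) = r := by
    intro f hf
    refine (hM (R f)).nonneg hX fun x => ?_
    let g : C(Spec A, ℂ) :=
      ⟨fun s => (Real.sqrt (f s) : ℂ),
        Complex.continuous_ofReal.comp (Real.continuous_sqrt.comp f.continuous)⟩
    let b : A := (gelfandStarTransform A).symm g
    have hb : ∀ s : Spec A, s b = (Real.sqrt (f s) : ℂ) := fun s => by
      have := congrArg (fun g : C(Spec A, ℂ) => g s) ((gelfandStarTransform A).apply_symm_apply g)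
      simpa using! this
    have : R f = star b * b := inj _ _ fun s => by
      rw [hR, map_mul, map_star, hb]
      simp only [RCLike.star_def, Complex.conj_ofReal]
      rw [← Complex.ofReal_mul, Real.mul_self_sqrt (hf s)]
    refine ⟨Complex.normSq ((b : X →ᵇ ℂ) x), Complex.normSq_nonneg _, ?_⟩
    rw [this, Complex.normSq_eq_conj_mul_self]
    rfl
  have hadd : ∀ f g, R (f + g) = R f + R g := fun f g => inj _ _ fun s => by
    simp [hR]
  have hsmul : ∀ (a : ℝ) f, R (a • f) = (a : ℂ) • R f := fun a f => inj _ _ fun s => by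
    rw [hR, map_smul, hR]
    simp
  let L : CompactlySupportedContinuousMap (Spec A) ℝ →ₗ[ℝ] ℝ :=
    { toFun := fun f => (meanValue E lam (R f : X →ᵇ ℂ)).re
      map_add' := fun f g => by
        rw [hadd, ← Complex.add_re]
        exact congrArg Complex.re (((hM (R f)).add hX (hM (R g))).meanValue_eq hX)
      map_smul' := fun a f => by
        rw [hsmul]
        refine (congrArg Complex.re (((hM (R f)).smul (a : ℂ)).meanValue_eq hX)).trans ?_
        simp }
  have hL : ∀ f, 0 ≤ f → 0 ≤ L f := fun f hf => by
    obtain ⟨r, h0, hr⟩ := hnn f hf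
    change 0 ≤ (meanValue E lam (R f : X →ᵇ ℂ)).re
    rw [hr]; exact h0
  have hML : ∀ f, meanValue E lam (R f : X →ᵇ ℂ) = L f := fun f => by
    obtain ⟨r, -, hr⟩ := hnn (f ⊔ 0) fun s => by simp
    obtain ⟨r', -, hr'⟩ := hnn ((-f) ⊔ 0) fun s => by simp
    have h : R f = R (f ⊔ 0) + (-1 : ℂ) • R ((-f) ⊔ 0) := inj _ _ fun s => by
      rw [map_add, map_smul, hR, hR, hR]
      simp only [CompactlySupportedContinuousMap.sup_apply,
        CompactlySupportedContinuousMap.zero_apply, CompactlySupportedContinuousMap.neg_apply,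
        smul_eq_mul, neg_one_mul]
      rw [← Complex.ofReal_neg, ← Complex.ofReal_add, Complex.ofReal_inj]
      rcases le_total (f s) 0 with h | h <;> simp [h]
    have h2 : meanValue E lam (R f : X →ᵇ ℂ) = r + (-1) * r' := by
      rw [h, ← hr, ← hr']
      exact ((hM _).add hX ((hM _).smul (-1 : ℂ))).meanValue_eq hX
    change _ = ((meanValue E lam (R f : X →ᵇ ℂ)).re : ℂ)
    rw [h2]
    simp
  refine ⟨PositiveLinearMap.mk₀ L hL, fun u => ?_⟩
  have hcont : Continuous fun s : Spec A => s u := (gelfandStarTransform A u).continuous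
  let f : CompactlySupportedContinuousMap (Spec A) ℝ :=
    ⟨⟨fun s => (s u).re, Complex.continuous_re.comp hcont⟩, HasCompactSupport.of_compactSpace _⟩
  let g : CompactlySupportedContinuousMap (Spec A) ℝ :=
    ⟨⟨fun s => (s u).im, Complex.continuous_im.comp hcont⟩, HasCompactSupport.of_compactSpace _⟩
  have hs : ∀ s : Spec A, s u = f s + Complex.I * g s := fun s => by
    rw [mul_comm]; exact (Complex.re_add_im _).symm
  refine ⟨f, g, hs, ?_⟩
  have hu : u = R f + Complex.I • R g := inj _ _ fun s => by
    rw [map_add, map_smul, hR, hR, smul_eq_mul, ← hs]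
  refine Eq.trans ?_ (congrArg₂ (fun a b => a + Complex.I * b) (hML f) (hML g))
  conv_lhs => rw [hu]
  exact ((hM _).add hX ((hM _).smul Complex.I)).meanValue_eq hX

/-- Existence of the representing measure of the mean value. -/
theorem exists_isMMeasure (hX : IsHomogenizer E lam) (hA : IsHomogenizationAlgebra E lam A) :
    ∃ β : Measure (Spec A), IsMMeasure E lam A β := by
  have := hA.isClosed
  obtain ⟨Λ, hΛ⟩ := exists_isMMeasure_aux hX hA
  refine ⟨RealRMK.rieszMeasure Λ, inferInstance, fun u => ?_⟩
  obtain ⟨f, g, hfg, hM⟩ := hΛ u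
  have hint : ∀ f : CompactlySupportedContinuousMap (Spec A) ℝ,
      Integrable (fun s => (f s : ℂ)) (RealRMK.rieszMeasure Λ) := fun f => f.integrable.ofReal
  simp_rw [hM, hfg]
  rw [integral_add (hint f) ((hint g).const_mul _), integral_const_mul, integral_complex_ofReal,
    integral_complex_ofReal, RealRMK.integral_rieszMeasure, RealRMK.integral_rieszMeasure]

/-- Uniqueness of the representing measure of the mean value. -/
theorem IsMMeasure.unique (hA : IsHomogenizationAlgebra E lam A) {β γ : Measure (Spec A)}
    (hβ : IsMMeasure E lam A β) (hγ : IsMMeasure E lam A γ) : β = γ := by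
  have := hA.isClosed
  have := hβ.1
  have := hγ.1
  refine Measure.ext_of_integral_eq_on_compactlySupported fun f => ?_
  let T : C(Spec A, ℂ) := ⟨fun s => (f s : ℂ), Complex.continuous_ofReal.comp f.continuous⟩
  have hT : ∀ s : Spec A, s ((gelfandStarTransform A).symm T) = f s := fun s => by
    have := congrArg (fun g : C(Spec A, ℂ) => g s) ((gelfandStarTransform A).apply_symm_apply T)
    simpa using! this
  have h := (hβ.2 ((gelfandStarTransform A).symm T)).symm.trans (hγ.2 _)
  simp_rw [hT, integral_complex_ofReal] at h
  exact_mod_cast h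

/-- The measure `β` on `Δ(A)`: the unique Radon measure with `M(u) = ∫ s(u) dβ(s)` for all
`u ∈ A`. -/
def mMeasure (hX : IsHomogenizer E lam) (hA : IsHomogenizationAlgebra E lam A) :
    Measure (Spec A) := (exists_isMMeasure hX hA).choose

theorem mMeasure_spec (hX : IsHomogenizer E lam) (hA : IsHomogenizationAlgebra E lam A) :
    IsMMeasure E lam A (mMeasure hX hA) := (exists_isMMeasure hX hA).choose_spec

/-- A fundamental sequence: `ε_n ∈ E`, `ε_n ≤ e`, and `ε_n → θ`. -/
def IsFundamentalSequence (ε : ℕ → E) : Prop :=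
  (∀ n, ε n ≤ 1) ∧ Tendsto ε atTop (toTheta E)

/-- Weak `Σ`-convergence in `L^p(Ω)` of `u_n = u_{ε_n}` to `u₀ ∈ L^p(Ω × Δ(A))`, along the sequence
`ε_n → θ`: for every `ψ ∈ L^{p'}(Ω; A)`, the integrals over `Ω` of `u_{ε}(x) ψ(x)(H_ε x)` converge
to the integral over `Ω × Δ(A)` of `u₀(x, s)` times the Gelfand transform `s(ψ(x))` of `ψ(x)` at
`s`. -/
def WeaklySigmaConverges (hX : IsHomogenizer E lam) (hA : IsHomogenizationAlgebra E lam A)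
    (Ω : Set X) (p : ℝ≥0∞) (ε : ℕ → E) (u : ℕ → Lp ℂ p (lam.restrict Ω))
    (u₀ : Lp ℂ p ((lam.restrict Ω).prod (mMeasure hX hA))) : Prop :=
  ∀ ψ : Lp A p.conjExponent (lam.restrict Ω),
    Tendsto (fun n => ∫ x in Ω, u n x * (ψ x : X →ᵇ ℂ) (ε n • x) ∂lam) atTop
      (𝓝 (∫ z : X × Spec A, u₀ z * z.2 (ψ z.1) ∂((lam.restrict Ω).prod (mMeasure hX hA))))

end MMeasure

end SigmaConvergence

end

namespace SigmaConvergence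

section LpDuality

variable {α : Type*} [MeasurableSpace α] {μ : Measure α} {p q : ℝ≥0∞}

/-- Dominated convergence in `L^q`. -/
theorem tendsto_toLp_of_dominated [Fact (1 ≤ q)] (hq : q ≠ ∞) {ι : Type*} {l : Filter ι}
    [l.IsCountablyGenerated] {F : ι → α → ℂ} {f : α → ℂ} {h : α → ℝ} (hF : ∀ i, MemLp (F i) q μ)
    (hf : MemLp f q μ) (hh : MemLp h q μ) (hb : ∀ i, ∀ᵐ x ∂μ, ‖F i x‖ ≤ h x)
    (hlim : ∀ᵐ x ∂μ, Tendsto (fun i => F i x) l (𝓝 (f x))) :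
    Tendsto (fun i => (hF i).toLp (F i)) l (𝓝 (hf.toLp f)) := by
  have hq0 : q ≠ 0 := (zero_lt_one.trans_le (Fact.out : 1 ≤ q)).ne'
  have hq' : 0 < q.toReal := ENNReal.toReal_pos hq0 hq
  rw [Lp.tendsto_Lp_iff_tendsto_eLpNorm'']
  have key : Tendsto (fun i => ∫ x, ‖(F i - f) x‖ ^ q.toReal ∂μ) l (𝓝 (∫ _, (0 : ℝ) ∂μ)) := by
    refine tendsto_integral_filter_of_dominated_convergence
      (fun x => ‖h x + ‖f x‖‖ ^ q.toReal)
      (Eventually.of_forall fun i => ?_) (Eventually.of_forall fun i => ?_) ?_ ?_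
    · exact (((hF i).sub hf).integrable_norm_rpow hq0 hq).aestronglyMeasurable
    · filter_upwards [hb i] with x hx
      rw [Real.norm_of_nonneg (by positivity)]
      refine Real.rpow_le_rpow (norm_nonneg _) ?_ hq'.le
      refine (norm_sub_le _ _).trans ((add_le_add_left hx _).trans (le_abs_self _))
    · exact (hh.add hf.norm).integrable_norm_rpow hq0 hq
    · filter_upwards [hlim] with x hx
      have : Tendsto (fun i => ‖F i x - f x‖) l (𝓝 0) := tendsto_iff_norm_sub_tendsto_zero.1 hx
      simpa [Real.zero_rpow hq'.ne'] using this.rpow_const (p := q.toReal) (Or.inr hq'.le)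
  simp_rw [fun i => ((hF i).sub hf).eLpNorm_eq_integral_rpow_norm hq0 hq]
  have h2 := key.rpow_const (p := q.toReal⁻¹) (Or.inr (by positivity))
  simpa [Real.zero_rpow (inv_pos.2 hq').ne'] using ENNReal.tendsto_ofReal h2

/-- A σ-finite measure admits a positive measurable function in `L^q`. -/
theorem exists_pos_memLp [SigmaFinite μ] (hq0 : q ≠ 0) (hq : q ≠ ∞) :
    ∃ w : α → ℝ, (∀ x, 0 < w x) ∧ Measurable w ∧ MemLp w q μ := by
  obtain ⟨g, hg0, hgm, hg⟩ := exists_pos_lintegral_lt_of_sigmaFinite μ one_ne_zero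
  have hq' : 0 < q.toReal := ENNReal.toReal_pos hq0 hq
  refine ⟨fun x => (g x : ℝ) ^ q.toReal⁻¹, fun x => Real.rpow_pos_of_pos (hg0 x) _,
    hgm.coe_nnreal_real.pow_const _, (hgm.coe_nnreal_real.pow_const _).aestronglyMeasurable, ?_⟩
  rw [eLpNorm_lt_top_iff_lintegral_rpow_enorm_lt_top hq0 hq]
  refine lt_of_eq_of_lt (lintegral_congr fun x => ?_) (hg.trans ENNReal.one_lt_top)
  rw [Real.enorm_eq_ofReal (by positivity), ENNReal.ofReal_rpow_of_nonneg (by positivity) hq'.le,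
    ← Real.rpow_mul (g x).coe_nonneg, inv_mul_cancel₀ hq'.ne', Real.rpow_one, ENNReal.ofReal_coe_nnreal]

theorem toLp_eq_zero {f : α → ℂ} (hf : MemLp f q μ) (h : f =ᵐ[μ] 0) : hf.toLp f = 0 :=
  Lp.ext (hf.coeFn_toLp.trans (h.trans (Lp.coeFn_zero ℂ q μ).symm))

variable [Fact (1 ≤ q)]

theorem hasSum_toLp_indicator (hq : q ≠ ∞) {v : α → ℂ} (hv : MemLp v q μ) {S : ℕ → Set α}
    (hS : ∀ i, MeasurableSet (S i)) (hd : Pairwise (Function.onFun Disjoint S)) :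
    HasSum (fun i => (hv.indicator (hS i)).toLp ((S i).indicator v))
      ((hv.indicator (MeasurableSet.iUnion hS)).toLp ((⋃ i, S i).indicator v)) := by
  have hfin : ∀ t : Finset ℕ, MeasurableSet (⋃ i ∈ t, S i) := fun t =>
    t.measurableSet_biUnion fun i _ => hS i
  have hsum : ∀ t : Finset ℕ, ∑ i ∈ t, (hv.indicator (hS i)).toLp ((S i).indicator v) =
      (hv.indicator (hfin t)).toLp ((⋃ i ∈ t, S i).indicator v) := fun t => by
    induction t using Finset.induction_on with
    | empty => exact (toLp_eq_zero _ (ae_of_all _ fun x => by simp)).symm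
    | insert i t hi ih =>
      rw [Finset.sum_insert hi, ih, ← MemLp.toLp_add]
      refine MemLp.toLp_congr _ _ (ae_of_all _ fun x => ?_)
      rw [Finset.set_biUnion_insert, indicator_union_of_disjoint]
      · rfl
      · exact disjoint_iUnion₂_right.2 fun j hj => hd fun h => hi (h ▸ hj)
  rw [HasSum, SummationFilter.unconditional_filter]
  simp_rw [hsum]
  refine tendsto_toLp_of_dominated hq _ _ hv.norm (fun t => ae_of_all _ fun x => ?_)
    (ae_of_all _ fun x => ?_)
  · exact norm_indicator_le_norm_self _ _
  · exact (tendsto_indicator_biUnion_finset S v x).mono_right (pure_le_nhds _)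

/-- The complex measure `S ↦ G (v 1_S)` attached to a continuous linear form `G` on `L^q`. -/
noncomputable def weightedMeasure (hq : q ≠ ∞) (G : Lp ℂ q μ →L[ℂ] ℂ) {v : α → ℂ}
    (hv : MemLp v q μ) : ComplexMeasure α where
  measureOf' S := open Classical in
    if hS : MeasurableSet S then G ((hv.indicator hS).toLp (S.indicator v)) else 0
  empty' := by
    rw [dif_pos MeasurableSet.empty, ← map_zero G]
    exact congrArg G (toLp_eq_zero _ (ae_of_all _ fun x => by simp))
  not_measurable' S hS := dif_neg hS
  m_iUnion' S hS hd := by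
    rw [dif_pos (MeasurableSet.iUnion hS)]
    simp_rw [dif_pos (hS _)]
    exact (hasSum_toLp_indicator hq hv hS hd).mapL G

theorem weightedMeasure_apply (hq : q ≠ ∞) (G : Lp ℂ q μ →L[ℂ] ℂ) {v : α → ℂ} (hv : MemLp v q μ)
    {S : Set α} (hS : MeasurableSet S) :
    weightedMeasure hq G hv S = G ((hv.indicator hS).toLp (S.indicator v)) :=
  dif_pos hS

/-- Radon-Nikodym theorem for complex measures. -/
theorem exists_integrable_of_absolutelyContinuous [SigmaFinite μ] (c : ComplexMeasure α)
    (hc : ∀ S, MeasurableSet S → μ S = 0 → c S = 0) :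
    ∃ g : α → ℂ, Integrable g μ ∧ ∀ S, MeasurableSet S → c S = ∫ x in S, g x ∂μ := by
  have hac : ∀ d : SignedMeasure α, (∀ S, MeasurableSet S → μ S = 0 → d S = 0) →
      ∀ S, MeasurableSet S → d S = ∫ x in S, d.rnDeriv μ x ∂μ := fun d hd S hS => by
    rw [← withDensityᵥ_apply (d.integrable_rnDeriv μ) hS, d.withDensityᵥ_rnDeriv_eq]
    refine VectorMeasure.AbsolutelyContinuous.mk fun S hS h => hd S hS ?_
    rwa [Measure.toENNRealVectorMeasure_apply_measurable hS] at h
  refine ⟨c.rnDeriv μ, c.integrable_rnDeriv μ, fun S hS => ?_⟩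
  have hre : (c S).re = _ := hac (ComplexMeasure.re c) (fun S hS h => by
    change (c S).re = 0; rw [hc S hS h]; rfl) S hS
  have him : (c S).im = _ := hac (ComplexMeasure.im c) (fun S hS h => by
    change (c S).im = 0; rw [hc S hS h]; rfl) S hS
  have hi := (c.integrable_rnDeriv μ).integrableOn (s := S)
  refine Complex.ext ?_ ?_
  · rw [hre]; exact integral_re hi
  · rw [him]; exact integral_im hi

/-- A continuous linear form on `L^q` is, on functions `w t` with `t` bounded, integration of `t`
against an integrable function. -/
theorem exists_density [SigmaFinite μ] (hq : q ≠ ∞) (G : Lp ℂ q μ →L[ℂ] ℂ) {v : α → ℂ}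
    (hv : MemLp v q μ) :
    ∃ g : α → ℂ, Integrable g μ ∧ ∀ (t : α → ℂ) (c : ℝ), StronglyMeasurable t → (∀ x, ‖t x‖ ≤ c) →
      ∀ h : MemLp (fun x => t x * v x) q μ, G (h.toLp _) = ∫ x, t x * g x ∂μ := by
  obtain ⟨g, hg, hgS⟩ := exists_integrable_of_absolutelyContinuous (μ := μ)
    (weightedMeasure hq G hv) fun S hS h => by
      rw [weightedMeasure_apply hq G hv hS, ← map_zero G]
      exact congrArg G (toLp_eq_zero _ (indicator_meas_zero h))
  refine ⟨g, hg, ?_⟩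
  have hmem : ∀ s : SimpleFunc α ℂ, MemLp (fun x => s x * v x) q μ := fun s => by
    obtain ⟨C, hC⟩ := s.exists_forall_norm_le
    exact hv.of_le_mul (c := C) (s.stronglyMeasurable.aestronglyMeasurable.mul hv.1)
      (ae_of_all _ fun x => by rw [norm_mul]; gcongr; exact hC x)
  have hint : ∀ s : SimpleFunc α ℂ, Integrable (fun x => s x * g x) μ := fun s => by
    obtain ⟨C, hC⟩ := s.exists_forall_norm_le
    exact hg.bdd_mul s.stronglyMeasurable.aestronglyMeasurable (ae_of_all _ hC)
  have hsimple : ∀ s : SimpleFunc α ℂ, G ((hmem s).toLp _) = ∫ x, s x * g x ∂μ := fun s => by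
    induction s using SimpleFunc.induction with
    | const c hS =>
      rename_i S
      have h1 : (hmem (SimpleFunc.piecewise S hS (SimpleFunc.const α c)
          (SimpleFunc.const α 0))).toLp _ = c • (hv.indicator hS).toLp (S.indicator v) := by
        rw [← MemLp.toLp_const_smul]
        refine MemLp.toLp_congr _ _ (ae_of_all _ fun x => ?_)
        by_cases hx : x ∈ S <;> simp [hx]
      rw [h1, map_smul, ← weightedMeasure_apply hq G hv hS, hgS S hS, ← integral_indicator hS,
        smul_eq_mul, ← integral_const_mul]
      refine integral_congr_ae (ae_of_all _ fun x => ?_)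
      by_cases hx : x ∈ S <;> simp [hx]
    | add hd h1 h2 =>
      rename_i f f'
      have : (hmem (f + f')).toLp _ = (hmem f).toLp _ + (hmem f').toLp _ := by
        rw [← MemLp.toLp_add]
        exact MemLp.toLp_congr _ _ (ae_of_all _ fun x => by simp [add_mul])
      rw [this, map_add, h1, h2, ← integral_add (hint f) (hint f')]
      simp [add_mul]
  intro t c ht hc h
  rcases isEmpty_or_nonempty α with hα | ⟨⟨x₀⟩⟩
  · have : h.toLp _ = 0 := toLp_eq_zero _ (ae_of_all _ fun x => hα.elim x)
    rw [this, map_zero, Measure.eq_zero_of_isEmpty μ, integral_zero_measure]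
  have hc0 : 0 ≤ c := (norm_nonneg _).trans (hc x₀)
  have hL : Tendsto (fun n => (hmem (ht.approxBounded c n)).toLp _) atTop (𝓝 (h.toLp _)) := by
    refine tendsto_toLp_of_dominated hq _ _ (hv.norm.const_mul c)
      (fun n => ae_of_all _ fun x => ?_) (ae_of_all _ fun x => ?_)
    · rw [norm_mul]; gcongr; exact ht.norm_approxBounded_le hc0 n x
    · exact (ht.tendsto_approxBounded_of_norm_le (hc x)).mul_const _
  have hR : Tendsto (fun n => ∫ x, ht.approxBounded c n x * g x ∂μ) atTop
      (𝓝 (∫ x, t x * g x ∂μ)) := by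
    refine tendsto_integral_of_dominated_convergence (fun x => c * ‖g x‖)
      (fun n => (hint _).aestronglyMeasurable) (hg.norm.const_mul c)
      (fun n => ae_of_all _ fun x => ?_) (ae_of_all _ fun x => ?_)
    · rw [norm_mul]; gcongr; exact ht.norm_approxBounded_le hc0 n x
    · exact (ht.tendsto_approxBounded_of_norm_le (hc x)).mul_const _
  refine tendsto_nhds_unique ((G.continuous.tendsto _).comp hL) (hR.congr fun n => ?_)
  exact (hsimple _).symm

end LpDuality

section LpDuality

variable {α : Type*} [MeasurableSpace α] {μ : Measure α} {p q : ℝ≥0∞}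

/-- If a measurable function integrates like a bounded linear form on `L^q` against all functions
dominated by multiples of a positive function of `L^q`, then it is in `L^p`. -/
theorem memLp_of_forall_integral_eq [Fact (1 ≤ q)] [p.HolderConjugate q] (hp : p ≠ ∞) (hq : q ≠ ∞)
    (G : Lp ℂ q μ →L[ℂ] ℂ) {w : α → ℝ} (hw0 : ∀ x, 0 < w x) (hwm : Measurable w)
    (hw : MemLp w q μ) {u : α → ℂ} (hu : Measurable u)
    (hG : ∀ (f : α → ℂ) (c : ℝ), Measurable f → (∀ x, ‖f x‖ ≤ c * w x) → ∀ h : MemLp f q μ,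
      Integrable (fun x => u x * f x) μ ∧ G (h.toLp f) = ∫ x, u x * f x ∂μ) :
    MemLp u p μ := by
  have hPQ : p.toReal.HolderConjugate q.toReal := ENNReal.HolderConjugate.toReal_of_ne_top hp hq
  set P := p.toReal
  set Q := q.toReal
  have hP : 1 < P := hPQ.lt
  have hq0 : q ≠ 0 := (zero_lt_one.trans_le (Fact.out : 1 ≤ q)).ne'
  have hp0 : p ≠ 0 := by rintro rfl; simp [P] at hP; linarith
  let A : ℕ → Set α := fun n => {x | ‖u x‖ ^ (P - 1) ≤ n * w x}
  have hA : ∀ n, MeasurableSet (A n) := fun n =>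
    measurableSet_le (hu.norm.pow_const _) (hwm.const_mul _)
  have hAmono : Monotone A := fun m n hmn x hx => by
    have := (hw0 x).le
    exact le_trans (b := m * w x) hx (by gcongr)
  have hAuniv : ⋃ n, A n = univ := by
    refine eq_univ_of_forall fun x => mem_iUnion.2 ?_
    obtain ⟨n, hn⟩ := exists_nat_ge (‖u x‖ ^ (P - 1) / w x)
    exact ⟨n, (div_le_iff₀ (hw0 x)).1 hn⟩
  have hbound : ∀ n, ∫⁻ x in A n, ‖u x‖ₑ ^ P ∂μ ≤ ENNReal.ofReal (‖G‖ ^ P) := fun n => by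
    let f : α → ℂ := (A n).indicator fun x => (starRingEnd ℂ) (u x) * ((‖u x‖ ^ (P - 2) : ℝ) : ℂ)
    have hpow : ∀ x, ‖u x‖ * ‖u x‖ ^ (P - 2) = ‖u x‖ ^ (P - 1) := fun x => by
      rcases eq_or_ne (‖u x‖) 0 with h | h
      · rw [h, zero_mul, Real.zero_rpow (by linarith)]
      · rw [← Real.rpow_one_add' (norm_nonneg _) (by linarith)]; ring_nf
    have hpow' : ∀ x, ‖u x‖ * ‖u x‖ ^ (P - 1) = ‖u x‖ ^ P := fun x => by
      rw [← Real.rpow_one_add' (norm_nonneg _) (by linarith)]; ring_nf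
    have hfn : ∀ x, ‖f x‖ = (A n).indicator (fun x => ‖u x‖ ^ (P - 1)) x := fun x => by
      by_cases hx : x ∈ A n
      · simp only [f, indicator_of_mem hx]
        rw [norm_mul, RCLike.norm_conj, Complex.norm_real, Real.norm_of_nonneg (by positivity), hpow]
      · simp [f, hx]
    have hfm : Measurable f := Measurable.indicator (by fun_prop) (hA n)
    have hfb : ∀ x, ‖f x‖ ≤ n * w x := fun x => by
      rw [hfn]
      exact indicator_apply_le' (fun h => h) fun _ => mul_nonneg n.cast_nonneg (hw0 x).le
    have hf : MemLp f q μ := hw.of_le_mul (c := n) hfm.aestronglyMeasurable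
      (ae_of_all _ fun x => (hfb x).trans (by gcongr; exact le_abs_self _))
    obtain ⟨hint, hGf⟩ := hG f n hfm hfb hf
    have huf : ∀ x, u x * f x = (((A n).indicator (fun x => ‖u x‖ ^ P) x : ℝ) : ℂ) := fun x => by
      by_cases hx : x ∈ A n
      · simp only [f, indicator_of_mem hx]
        rw [← mul_assoc, Complex.mul_conj, Complex.normSq_eq_norm_sq, ← Complex.ofReal_mul, sq,
          mul_assoc, hpow, hpow']
      · simp [f, hx]
    simp_rw [huf] at hint hGf
    have hint' : Integrable ((A n).indicator (fun x => ‖u x‖ ^ P)) μ := by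
      simpa using hint.re
    rw [integral_complex_ofReal] at hGf
    set I := ∫ x, (A n).indicator (fun x => ‖u x‖ ^ P) x ∂μ with hI
    have hI0 : 0 ≤ I := integral_nonneg fun x => indicator_nonneg (fun _ _ => by positivity) x
    have hnorm : ‖hf.toLp f‖ = I ^ Q⁻¹ := by
      rw [Lp.norm_toLp, hf.eLpNorm_eq_integral_rpow_norm hq0 hq, ENNReal.toReal_ofReal (by positivity)]
      congr 1
      refine integral_congr_ae (ae_of_all _ fun x => ?_)
      simp only [hfn]
      by_cases hx : x ∈ A n
      · simp only [indicator_of_mem hx]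
        rw [← Real.rpow_mul (norm_nonneg _), hPQ.sub_one_mul_conj]
      · simp only [indicator_of_notMem hx]
        exact Real.zero_rpow hPQ.symm.ne_zero
    have hle : I ≤ ‖G‖ * I ^ Q⁻¹ := by
      have := G.le_opNorm (hf.toLp f)
      rwa [hGf, hnorm, Complex.norm_real, Real.norm_of_nonneg hI0] at this
    have hIle : I ≤ ‖G‖ ^ P := by
      rcases hI0.eq_or_lt with h | h
      · rw [← h]; positivity
      have h1 : I ^ P⁻¹ * I ^ Q⁻¹ = I := by
        rw [← Real.rpow_add h, hPQ.inv_add_inv_eq_one, Real.rpow_one]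
      have h2 : I ^ P⁻¹ ≤ ‖G‖ := by
        refine le_of_mul_le_mul_right ?_ (Real.rpow_pos_of_pos h Q⁻¹)
        rwa [h1]
      calc I = (I ^ P⁻¹) ^ P := by
            rw [← Real.rpow_mul hI0, inv_mul_cancel₀ (by linarith), Real.rpow_one]
        _ ≤ ‖G‖ ^ P := by gcongr
    calc ∫⁻ x in A n, ‖u x‖ₑ ^ P ∂μ = ENNReal.ofReal I := by
          rw [hI, ofReal_integral_eq_lintegral_ofReal hint'
            (ae_of_all _ fun x => indicator_nonneg (fun _ _ => by positivity) x),
            ← lintegral_indicator (hA n)]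
          refine lintegral_congr fun x => ?_
          by_cases hx : x ∈ A n
          · simp only [indicator_of_mem hx]
            rw [← ofReal_norm, ENNReal.ofReal_rpow_of_nonneg (norm_nonneg _) (by linarith)]
          · simp [hx]
      _ ≤ _ := ENNReal.ofReal_le_ofReal hIle
  refine ⟨hu.aestronglyMeasurable, ?_⟩
  rw [eLpNorm_lt_top_iff_lintegral_rpow_enorm_lt_top hp0 hp, ← setLIntegral_univ, ← hAuniv,
    setLIntegral_iUnion_of_directed _ hAmono.directed_le]
  exact (iSup_le hbound).trans_lt ENNReal.ofReal_lt_top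

/-- Every continuous linear form on `L^q` of a σ-finite measure is given by a function in `L^p`,
for conjugate exponents `1 < p, q < ∞`. -/
theorem exists_Lp_forall_integral_eq [SigmaFinite μ] [Fact (1 ≤ p)] [Fact (1 ≤ q)]
    [p.HolderConjugate q] (hp : p ≠ ∞) (hq : q ≠ ∞) (G : Lp ℂ q μ →L[ℂ] ℂ) :
    ∃ u : Lp ℂ p μ, ∀ f : Lp ℂ q μ, G f = ∫ x, u x * f x ∂μ := by
  have hq0 : q ≠ 0 := (zero_lt_one.trans_le (Fact.out : 1 ≤ q)).ne'
  obtain ⟨w, hw0, hwm, hw⟩ := exists_pos_memLp (μ := μ) hq0 hq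
  obtain ⟨g, hg, hgG⟩ := exists_density hq G (hw.ofReal (K := ℂ))
  let g' := hg.1.mk g
  have hgm : Measurable g' := hg.1.stronglyMeasurable_mk.measurable
  have hgg' : g =ᵐ[μ] g' := hg.1.ae_eq_mk
  have hg' : Integrable g' μ := hg.congr hgg'
  let u : α → ℂ := fun x => g' x / w x
  have hu : Measurable u := by fun_prop
  have hwne : ∀ x, (w x : ℂ) ≠ 0 := fun x => Complex.ofReal_ne_zero.2 (hw0 x).ne'
  have hG : ∀ (f : α → ℂ) (c : ℝ), Measurable f → (∀ x, ‖f x‖ ≤ c * w x) → ∀ h : MemLp f q μ,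
      Integrable (fun x => u x * f x) μ ∧ G (h.toLp f) = ∫ x, u x * f x ∂μ := by
    intro f c hf hc h
    have hfw : f = fun x => f x / w x * w x := funext fun x => (div_mul_cancel₀ _ (hwne x)).symm
    have hm : StronglyMeasurable fun x => f x / w x :=
      Measurable.stronglyMeasurable (by fun_prop)
    have hb : ∀ x, ‖f x / w x‖ ≤ c := fun x => by
      rw [norm_div, Complex.norm_real, Real.norm_of_nonneg (hw0 x).le, div_le_iff₀ (hw0 x)]
      exact hc x
    have hu' : ∀ x, u x * f x = f x / w x * g' x := fun x => by
      simp only [u]; ring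
    simp_rw [hu']
    refine ⟨hg'.bdd_mul hm.aestronglyMeasurable (ae_of_all _ hb), ?_⟩
    have h' : MemLp (fun x => f x / w x * w x) q μ := hfw ▸ h
    have e : h.toLp f = h'.toLp _ := MemLp.toLp_congr _ _ (ae_of_all _ fun x => congrFun hfw x)
    rw [e]
    refine (hgG _ c hm hb h').trans (integral_congr_ae ?_)
    filter_upwards [hgg'] with x hx
    rw [hx]
  have hup := memLp_of_forall_integral_eq (p := p) hp hq G hw0 hwm hw hu hG
  refine ⟨hup.toLp u, fun f => ?_⟩
  let B := ContinuousLinearMap.lpPairing μ p q (ContinuousLinearMap.mul ℂ ℂ) (hup.toLp u)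
  have hB : ∀ f : Lp ℂ q μ, B f = ∫ x, hup.toLp u x * f x ∂μ := fun f =>
    ContinuousLinearMap.lpPairing_eq_integral _ _ _
  rw [← hB]
  let A : ℕ → Set α := fun n => {x | ‖f x‖ ≤ n * w x}
  have hfm : Measurable f := (Lp.stronglyMeasurable f).measurable
  have hA : ∀ n, MeasurableSet (A n) := fun n =>
    measurableSet_le hfm.norm (hwm.const_mul _)
  have hmem : ∀ n, MemLp ((A n).indicator f) q μ := fun n => (Lp.memLp f).indicator (hA n)
  have hlim : Tendsto (fun n => (hmem n).toLp _) atTop (𝓝 f) := by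
    rw [← congrArg 𝓝 (Lp.toLp_coeFn f (Lp.memLp f))]
    refine tendsto_toLp_of_dominated hq _ _ (Lp.memLp f).norm
      (fun n => ae_of_all _ fun x => norm_indicator_le_norm_self _ _) (ae_of_all _ fun x => ?_)
    obtain ⟨n, hn⟩ := exists_nat_ge (‖f x‖ / w x)
    refine tendsto_const_nhds.congr' ((eventually_ge_atTop n).mono fun m hm => ?_)
    have hx : x ∈ A m := (div_le_iff₀ (hw0 x)).1 (hn.trans (Nat.cast_le.2 hm))
    exact (indicator_of_mem hx _).symm
  refine tendsto_nhds_unique ((G.continuous.tendsto _).comp hlim)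
    (((B.continuous.tendsto _).comp hlim).congr fun n => ?_)
  simp only [Function.comp, hB]
  rw [(hG ((A n).indicator f) n (hfm.indicator (hA n)) (fun x => ?_) (hmem n)).2]
  · refine integral_congr_ae ?_
    filter_upwards [hup.coeFn_toLp, (hmem n).coeFn_toLp] with x h1 h2
    rw [h1, h2]
  · by_cases hx : x ∈ A n
    · rw [indicator_of_mem hx]; exact hx
    · rw [indicator_of_notMem hx, norm_zero]; exact mul_nonneg n.cast_nonneg (hw0 x).le

end LpDuality

section Evaluation

variable {X Z B : Type*} [MeasurableSpace X] [MeasurableSpace Z] [NormedAddCommGroup B]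
  [NormedSpace ℂ B] [SecondCountableTopology B] {μ : Measure X} {ν : Measure Z} {q : ℝ≥0∞}
  {π : Z → X} {Φ : Z → B →L[ℂ] ℂ}

/-- A weakly measurable family of contractive linear forms on `B`. -/
structure IsEvaluation (Φ : Z → B →L[ℂ] ℂ) : Prop where
  measurable : ∀ a, Measurable fun z => Φ z a
  norm_le : ∀ z a, ‖Φ z a‖ ≤ ‖a‖

theorem IsEvaluation.aestronglyMeasurable (hΦ : IsEvaluation Φ) (hπ : MeasurePreserving π ν μ)
    {f : X → B} (hf : AEStronglyMeasurable f μ) :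
    AEStronglyMeasurable (fun z => Φ z (f (π z))) ν := by
  borelize B
  have h := stronglyMeasurable_uncurry_of_continuous_of_stronglyMeasurable
    (u := fun (a : B) z => Φ z a) (fun z => (Φ z).continuous)
    fun a => (hΦ.measurable a).stronglyMeasurable
  have hm : Measurable fun z => (hf.mk f (π z), z) :=
    (hf.stronglyMeasurable_mk.measurable.comp hπ.measurable).prodMk measurable_id
  refine ⟨_, h.comp_measurable hm, ?_⟩
  filter_upwards [hπ.quasiMeasurePreserving.ae_eq_comp hf.ae_eq_mk] with z hz
  simp only [Function.comp] at hz
  simp [hz]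

theorem IsEvaluation.memLp (hΦ : IsEvaluation Φ) (hπ : MeasurePreserving π ν μ)
    {f : X → B} (hf : MemLp f q μ) : MemLp (fun z => Φ z (f (π z))) q ν :=
  (hf.comp_measurePreserving hπ).of_le (hΦ.aestronglyMeasurable hπ hf.1)
    (ae_of_all _ fun z => hΦ.norm_le z _)

variable [Fact (1 ≤ q)]

/-- The contraction `f ↦ (z ↦ Φ z (f (π z)))` from `L^q(X; B)` to `L^q(Z)`. -/
noncomputable def evalLp (hΦ : IsEvaluation Φ) (hπ : MeasurePreserving π ν μ) :
    Lp B q μ →L[ℂ] Lp ℂ q ν :=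
  LinearMap.mkContinuous
    { toFun := fun f => (hΦ.memLp hπ (Lp.memLp f)).toLp _
      map_add' := fun f g => by
        rw [← MemLp.toLp_add]
        refine MemLp.toLp_congr _ _ ?_
        filter_upwards [hπ.quasiMeasurePreserving.ae_eq_comp (Lp.coeFn_add f g)] with z hz
        simp only [Function.comp] at hz
        simp only [hz, Pi.add_apply, map_add]
      map_smul' := fun c f => by
        rw [RingHom.id_apply, ← MemLp.toLp_const_smul]
        refine MemLp.toLp_congr _ _ ?_
        filter_upwards [hπ.quasiMeasurePreserving.ae_eq_comp (Lp.coeFn_smul c f)] with z hz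
        simp only [Function.comp] at hz
        simp only [hz, Pi.smul_apply, map_smul] } 1 fun f => by
    change ‖(hΦ.memLp hπ (Lp.memLp f)).toLp _‖ ≤ _
    rw [one_mul, Lp.norm_toLp, Lp.norm_def]
    refine ENNReal.toReal_mono (Lp.memLp f).eLpNorm_ne_top ?_
    rw [← eLpNorm_comp_measurePreserving (Lp.memLp f).1 hπ]
    exact eLpNorm_mono fun z => hΦ.norm_le z _

theorem evalLp_coeFn (hΦ : IsEvaluation Φ) (hπ : MeasurePreserving π ν μ) (f : Lp B q μ) :
    evalLp hΦ hπ f =ᵐ[ν] fun z => Φ z (f (π z)) :=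
  (hΦ.memLp hπ (Lp.memLp f)).coeFn_toLp

theorem norm_evalLp_le (hΦ : IsEvaluation Φ) (hπ : MeasurePreserving π ν μ) :
    ‖evalLp (q := q) hΦ hπ‖ ≤ 1 :=
  LinearMap.mkContinuous_norm_le _ zero_le_one _

theorem norm_rpow_evalLp_toLp (hq : q ≠ ∞) (hΦ : IsEvaluation Φ) (hπ : MeasurePreserving π ν μ)
    {f : X → B} (hf : MemLp f q μ) :
    ‖evalLp hΦ hπ (hf.toLp f)‖ ^ q.toReal = ∫ z, ‖Φ z (f (π z))‖ ^ q.toReal ∂ν := by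
  have hq0 : q ≠ 0 := (zero_lt_one.trans_le (Fact.out : 1 ≤ q)).ne'
  have hq' : 0 < q.toReal := ENNReal.toReal_pos hq0 hq
  rw [Lp.norm_def, (Lp.memLp _).eLpNorm_eq_integral_rpow_norm hq0 hq,
    ENNReal.toReal_ofReal (by positivity), ← Real.rpow_mul (by positivity),
    inv_mul_cancel₀ hq'.ne', Real.rpow_one]
  refine integral_congr_ae ?_
  filter_upwards [evalLp_coeFn hΦ hπ (hf.toLp f),
    hπ.quasiMeasurePreserving.ae_eq_comp hf.coeFn_toLp] with z h1 h2
  simp only [Function.comp] at h2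
  rw [h1, h2]

theorem norm_rpow_evalLp_add (hq : q ≠ ∞) (hΦ : IsEvaluation Φ) (hπ : MeasurePreserving π ν μ)
    {f g : X → B} (hf : MemLp f q μ) (hg : MemLp g q μ)
    (hd : Disjoint (Function.support f) (Function.support g)) :
    ‖evalLp hΦ hπ (hf.toLp f + hg.toLp g)‖ ^ q.toReal =
      ‖evalLp hΦ hπ (hf.toLp f)‖ ^ q.toReal + ‖evalLp hΦ hπ (hg.toLp g)‖ ^ q.toReal := by
  have hq0 : q ≠ 0 := (zero_lt_one.trans_le (Fact.out : 1 ≤ q)).ne'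
  have hq' : 0 < q.toReal := ENNReal.toReal_pos hq0 hq
  rw [← MemLp.toLp_add, norm_rpow_evalLp_toLp hq, norm_rpow_evalLp_toLp hq,
    norm_rpow_evalLp_toLp hq, ← integral_add ((hΦ.memLp hπ hf).integrable_norm_rpow hq0 hq)
      ((hΦ.memLp hπ hg).integrable_norm_rpow hq0 hq)]
  refine integral_congr_ae (ae_of_all _ fun z => ?_)
  by_cases hz : f (π z) = 0
  · simp [hz, Real.zero_rpow hq'.ne']
  · have : g (π z) = 0 := by
      by_contra hz'
      exact disjoint_left.1 hd hz hz'
    simp [this, Real.zero_rpow hq'.ne']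

theorem norm_rpow_evalLp_indicatorConstLp (hq : q ≠ ∞) (hΦ : IsEvaluation Φ)
    (hπ : MeasurePreserving π ν μ) (a : B) {S : Set X} (hS : MeasurableSet S) (hSμ : μ S ≠ ∞) :
    ‖evalLp hΦ hπ (indicatorConstLp q hS hSμ a)‖ ^ q.toReal =
      ∫ z in π ⁻¹' S, ‖Φ z a‖ ^ q.toReal ∂ν := by
  have hq0 : q ≠ 0 := (zero_lt_one.trans_le (Fact.out : 1 ≤ q)).ne'
  have hq' : 0 < q.toReal := ENNReal.toReal_pos hq0 hq
  rw [indicatorConstLp, norm_rpow_evalLp_toLp hq, ← integral_indicator (hπ.measurable hS)]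
  refine integral_congr_ae (ae_of_all _ fun z => ?_)
  by_cases hz : π z ∈ S
  · simp [hz]
  · simp [hz, Real.zero_rpow hq'.ne']

/-- If the `L^q` norms of the evaluations converge on indicator functions, they converge on
`L^q(X; B)`. -/
theorem tendsto_norm_evalLp (hq : q ≠ ∞) {Ψ : ℕ → X → B →L[ℂ] ℂ} (hΨ : ∀ n, IsEvaluation (Ψ n))
    (hΦ : IsEvaluation Φ) (hπ : MeasurePreserving π ν μ)
    (h : ∀ (a : B) (S : Set X), MeasurableSet S → μ S < ∞ →
      Tendsto (fun n => ∫ x in S, ‖Ψ n x a‖ ^ q.toReal ∂μ) atTop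
        (𝓝 (∫ z in π ⁻¹' S, ‖Φ z a‖ ^ q.toReal ∂ν))) (ψ : Lp B q μ) :
    Tendsto (fun n => ‖evalLp (hΨ n) (MeasurePreserving.id μ) ψ‖) atTop
      (𝓝 ‖evalLp hΦ hπ ψ‖) := by
  have hq0 : q ≠ 0 := (zero_lt_one.trans_le (Fact.out : 1 ≤ q)).ne'
  have hq' : 0 < q.toReal := ENNReal.toReal_pos hq0 hq
  have hroot : ∀ ψ : Lp B q μ,
      Tendsto (fun n => ‖evalLp (hΨ n) (MeasurePreserving.id μ) ψ‖ ^ q.toReal) atTop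
        (𝓝 (‖evalLp hΦ hπ ψ‖ ^ q.toReal)) →
      Tendsto (fun n => ‖evalLp (hΨ n) (MeasurePreserving.id μ) ψ‖) atTop
        (𝓝 ‖evalLp hΦ hπ ψ‖) := fun ψ hψ => by
    have := hψ.rpow_const (p := q.toReal⁻¹) (Or.inr (by positivity))
    simpa only [← Real.rpow_mul (norm_nonneg _), mul_inv_cancel₀ hq'.ne', Real.rpow_one] using this
  refine Lp.induction hq (motive := fun ψ : Lp B q μ =>
    Tendsto (fun n => ‖evalLp (hΨ n) (MeasurePreserving.id μ) ψ‖) atTop (𝓝 ‖evalLp hΦ hπ ψ‖))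
    (fun a S hS hSμ => hroot _ ?_) (fun f g hf hg hd h1 h2 => hroot _ ?_) ?_ ψ
  · rw [Lp.simpleFunc.coe_indicatorConst]
    simp_rw [norm_rpow_evalLp_indicatorConstLp hq]
    exact h a S hS hSμ
  · simp_rw [norm_rpow_evalLp_add hq _ _ hf hg hd]
    exact (h1.rpow_const (Or.inr hq'.le)).add (h2.rpow_const (Or.inr hq'.le))
  · have hlip : ∀ n, LipschitzWith 1 fun ψ => ‖evalLp (q := q) (hΨ n) (MeasurePreserving.id μ) ψ‖ :=
      fun n => LipschitzWith.of_dist_le_mul fun ψ ψ' => by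
        refine (abs_norm_sub_norm_le _ _).trans ?_
        rw [← map_sub, NNReal.coe_one, dist_eq_norm]
        exact ContinuousLinearMap.le_of_opNorm_le _ (norm_evalLp_le _ _) _
    exact (LipschitzWith.uniformEquicontinuous _ 1 hlip).equicontinuous.isClosed_setOfPred_tendsto
      (evalLp hΦ hπ).continuous.norm

end Evaluation

/-- A linear form dominated by the norm of `J` factors through `J` as a continuous linear form. -/
theorem exists_factorization_of_norm_le {V W : Type*} [NormedAddCommGroup V] [NormedSpace ℂ V]
    [NormedAddCommGroup W] [NormedSpace ℂ W] (J : V →L[ℂ] W) (F : V →ₗ[ℂ] ℂ) (K : ℝ)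
    (h : ∀ v, ‖F v‖ ≤ K * ‖J v‖) : ∃ G : W →L[ℂ] ℂ, ∀ v, G (J v) = F v := by
  let J' : V →ₗ[ℂ] W := J
  have hker : LinearMap.ker J' ≤ LinearMap.ker F := fun v hv => by
    have hv' : J v = 0 := hv
    have := h v
    rw [hv', norm_zero, mul_zero] at this
    exact norm_le_zero_iff.1 this
  let L : LinearMap.range J' →ₗ[ℂ] ℂ :=
    (LinearMap.ker J').liftQ F hker ∘ₗ J'.quotKerEquivRange.symm.toLinearMap
  have hL : ∀ v, L ⟨J v, v, rfl⟩ = F v := fun v => by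
    have : J'.quotKerEquivRange.symm ⟨J v, v, rfl⟩ = (LinearMap.ker J').mkQ v :=
      (LinearEquiv.symm_apply_eq _).2 rfl
    simp only [L, LinearMap.comp_apply, LinearEquiv.coe_coe]
    rw [this]
    exact Submodule.liftQ_apply _ _ _
  let L' : StrongDual ℂ (LinearMap.range J') := L.mkContinuous K <| by
    rintro ⟨_, v, rfl⟩
    exact (congrArg norm (hL v)).trans_le (h v)
  obtain ⟨G, hG, -⟩ := exists_extension_norm_eq _ L'
  exact ⟨G, fun v => (hG ⟨J v, v, rfl⟩).trans (hL v)⟩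

/-- A bounded sequence of linear forms on a separable space has a pointwise convergent
subsequence. -/
theorem exists_subseq_tendsto_dual {V : Type*} [NormedAddCommGroup V] [NormedSpace ℂ V]
    [TopologicalSpace.SeparableSpace V] (F : ℕ → V →L[ℂ] ℂ) (C : ℝ) (hF : ∀ n, ‖F n‖ ≤ C) :
    ∃ φ : ℕ → ℕ, StrictMono φ ∧ ∃ F₀ : V →L[ℂ] ℂ, ∀ v,
      Tendsto (fun n => F (φ n) v) atTop (𝓝 (F₀ v)) := by
  obtain ⟨F₀, -, φ, hφ, hlim⟩ := WeakDual.isSeqCompact_closedBall ℂ V 0 C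
    (x := fun n => StrongDual.toWeakDual (F n)) fun n => by simpa using! hF n
  exact ⟨φ, hφ, WeakDual.toStrongDual F₀, fun v =>
    ((WeakDual.eval_continuous v).tendsto F₀).comp hlim⟩

section Evaluation

variable {X Z B : Type*} [MeasurableSpace X] [MeasurableSpace Z] [NormedAddCommGroup B]
  [NormedSpace ℂ B] [SecondCountableTopology B] {μ : Measure X} {ν : Measure Z} {p q : ℝ≥0∞}
  {π : Z → X} {Φ : Z → B →L[ℂ] ℂ}

/-- Weak compactness of bounded sequences tested against evaluations whose norms converge. -/
theorem exists_subseq_tendsto_integral_evaluation [SigmaFinite ν] [Fact (1 ≤ p)] [Fact (1 ≤ q)]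
    [p.HolderConjugate q] (hp : p ≠ ∞) (hq : q ≠ ∞) [TopologicalSpace.SeparableSpace (Lp B q μ)]
    {Ψ : ℕ → X → B →L[ℂ] ℂ} (hΨ : ∀ n, IsEvaluation (Ψ n))
    (hΦ : IsEvaluation Φ) (hπ : MeasurePreserving π ν μ)
    (h : ∀ ψ : Lp B q μ, Tendsto (fun n => ‖evalLp (hΨ n) (MeasurePreserving.id μ) ψ‖) atTop
      (𝓝 ‖evalLp hΦ hπ ψ‖))
    (u : ℕ → Lp ℂ p μ) (C : ℝ) (hu : ∀ n, ‖u n‖ ≤ C) :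
    ∃ φ : ℕ → ℕ, StrictMono φ ∧ ∃ u₀ : Lp ℂ p ν, ∀ ψ : Lp B q μ,
      Tendsto (fun n => ∫ x, u (φ n) x * Ψ (φ n) x (ψ x) ∂μ) atTop
        (𝓝 (∫ z, u₀ z * Φ z (ψ (π z)) ∂ν)) := by
  let T : ℕ → Lp B q μ →L[ℂ] Lp ℂ q μ := fun n => evalLp (hΨ n) (MeasurePreserving.id μ)
  let J : Lp B q μ →L[ℂ] Lp ℂ q ν := evalLp hΦ hπ
  let P : Lp ℂ p μ →L[ℂ] Lp ℂ q μ →L[ℂ] ℂ :=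
    ContinuousLinearMap.lpPairing μ p q (ContinuousLinearMap.mul ℂ ℂ)
  let F : ℕ → Lp B q μ →L[ℂ] ℂ := fun n => (P (u n)).comp (T n)
  have hF : ∀ n ψ, F n ψ = ∫ x, u n x * Ψ n x (ψ x) ∂μ := fun n ψ => by
    refine (ContinuousLinearMap.lpPairing_eq_integral _ _ _).trans (integral_congr_ae ?_)
    filter_upwards [evalLp_coeFn (hΨ n) (MeasurePreserving.id μ) ψ] with x hx
    exact congrArg (u n x * ·) hx
  have hP : ∀ n, ‖P (u n)‖ ≤ ‖P‖ * C := fun n =>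
    (P.le_opNorm _).trans (by gcongr; exact hu n)
  have hC : 0 ≤ ‖P‖ * C := (norm_nonneg _).trans (hP 0)
  have hFn : ∀ n, ‖F n‖ ≤ ‖P‖ * C := fun n =>
    (ContinuousLinearMap.opNorm_comp_le _ _).trans
      ((mul_le_mul (hP n) (norm_evalLp_le _ _) (norm_nonneg _) hC).trans_eq (mul_one _))
  obtain ⟨φ, hφ, F₀, hF₀⟩ := exists_subseq_tendsto_dual F _ hFn
  have hbound : ∀ ψ, ‖F₀ ψ‖ ≤ ‖P‖ * C * ‖J ψ‖ := fun ψ =>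
    le_of_tendsto_of_tendsto' (hF₀ ψ).norm (((h ψ).comp hφ.tendsto_atTop).const_mul (‖P‖ * C))
      fun n => (P (u (φ n))).le_of_opNorm_le (hP _) _
  obtain ⟨G, hG⟩ := exists_factorization_of_norm_le J F₀.toLinearMap _ hbound
  obtain ⟨u₀, hu₀⟩ := exists_Lp_forall_integral_eq (p := p) hp hq G
  refine ⟨φ, hφ, u₀, fun ψ => ?_⟩
  have hlim : F₀ ψ = ∫ z, u₀ z * Φ z (ψ (π z)) ∂ν := by
    refine (hG ψ).symm.trans ((hu₀ _).trans (integral_congr_ae ?_))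
    filter_upwards [evalLp_coeFn hΦ hπ ψ] with z hz
    rw [hz]
  rw [← hlim]
  exact (hF₀ ψ).congr fun n => hF _ _

end Evaluation

section Spectrum

variable {X : Type*} [TopologicalSpace X] {A : StarSubalgebra ℂ (X →ᵇ ℂ)}

theorem continuous_spec_apply (a : A) : Continuous fun s : Spec A => s a :=
  (WeakDual.gelfandTransform ℂ A a).continuous

variable [IsClosed (A : Set (X →ᵇ ℂ))]

theorem norm_spec_apply_le (s : Spec A) (a : A) : ‖s a‖ ≤ ‖a‖ := by
  refine ((WeakDual.gelfandTransform ℂ A a).norm_coe_le_norm s).trans ?_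
  exact NonUnitalStarAlgHom.norm_apply_le (gelfandStarTransform A) a

/-- Evaluation at a point, as an element of the spectrum. -/
noncomputable def pointEval (A : StarSubalgebra ℂ (X →ᵇ ℂ)) [IsClosed (A : Set (X →ᵇ ℂ))]
    (x : X) : Spec A :=
  WeakDual.CharacterSpace.equivAlgHom.symm
    { toFun := fun a => (a : X →ᵇ ℂ) x
      map_one' := rfl
      map_mul' := fun _ _ => rfl
      map_zero' := rfl
      map_add' := fun _ _ => rfl
      commutes' := fun c => by simp [Algebra.algebraMap_eq_smul_one] }

theorem pointEval_apply (x : X) (a : A) : pointEval A x a = (a : X →ᵇ ℂ) x := rfl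

/-- A homogenization algebra contains the powers of the modulus of each of its elements. -/
theorem exists_norm_rpow (a : A) {r : ℝ} (hr : 0 ≤ r) :
    ∃ b : A, ∀ s : Spec A, s b = ((‖s a‖ ^ r : ℝ) : ℂ) := by
  let T : C(Spec A, ℂ) := ⟨fun s => ((‖s a‖ ^ r : ℝ) : ℂ), Complex.continuous_ofReal.comp
    ((continuous_spec_apply a).norm.rpow_const fun _ => Or.inr hr)⟩
  refine ⟨(gelfandStarTransform A).symm T, fun s => ?_⟩
  have := congrArg (fun g : C(Spec A, ℂ) => g s) ((gelfandStarTransform A).apply_symm_apply T)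
  simpa using! this

theorem isEvaluation_spec {Z : Type*} [MeasurableSpace Z] {σ : Z → Spec A}
    (hσ : ∀ a : A, Measurable fun z => σ z a) :
    IsEvaluation fun z => WeakDual.toStrongDual (σ z : WeakDual ℂ A) :=
  ⟨hσ, fun z a => norm_spec_apply_le (σ z) a⟩

end Spectrum

section Homogenizer

variable {E : Set ℝ} [CommGroup E] {X : Type*} [TopologicalSpace X] [MeasurableSpace X]
  [MulAction E X] {lam : Measure X} {A : StarSubalgebra ℂ (X →ᵇ ℂ)}

theorem IsRGroup.eventually_le (hE : IsRGroup E) (α : E) : ∀ᶠ ε in toTheta E, ε ≤ α := by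
  have := hE.ordered
  have : Nontrivial E := ⟨⟨_, hE.natCast_mem 1 one_pos⟩, ⟨_, hE.natCast_mem 2 two_pos⟩, by
    simp [Subtype.ext_iff]⟩
  obtain ⟨β, hβ⟩ := exists_lt α
  have h1 : theta E ≤ ((β : ℝ) : EReal) := sInf_le ⟨β, β.2, rfl⟩
  have h2 : theta E < ((α : ℝ) : EReal) := h1.trans_lt (EReal.coe_lt_coe_iff.2 hβ)
  filter_upwards [preimage_mem_comap (Iio_mem_nhds h2)] with ε hε
  exact (EReal.coe_lt_coe_iff.1 hε).le

theorem IsHomogenizer.sigmaCompactSpace (hX : IsHomogenizer E lam) {ε : ℕ → E}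
    (hε : Tendsto ε atTop (toTheta E)) : SigmaCompactSpace X := by
  have := hX.locallyCompact
  have := hX.continuous_action
  obtain ⟨ω, hω⟩ := hX.absorptive
  obtain ⟨K, hK, hKω⟩ := exists_compact_mem_nhds ω
  refine SigmaCompactSpace_iff_exists_compact_covering.2
    ⟨fun n => (fun x => ε n • x) '' K, fun n => hK.image (continuous_const_smul _),
      eq_univ_of_forall fun x => ?_⟩
  obtain ⟨U, hU, α, hα⟩ := hω K hKω x
  obtain ⟨n, hn⟩ := (hε.eventually (hX.rGroup.eventually_le α)).exists
  exact mem_iUnion.2 ⟨n, (ε n)⁻¹ • x, hα _ hn ⟨x, mem_of_mem_nhds hU, rfl⟩, smul_inv_smul _ _⟩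

theorem hasMeanValue_one : HasMeanValue E lam (1 : X →ᵇ ℂ) 1 := fun _ _ => by
  simpa using tendsto_const_nhds

theorem isProbabilityMeasure_of_isMMeasure (hX : IsHomogenizer E lam) [BorelSpace X]
    {β : Measure (Spec A)} (hβ : IsMMeasure E lam A β) : IsProbabilityMeasure β := by
  have h := hβ.2 1
  rw [OneMemClass.coe_one, hasMeanValue_one.meanValue_eq hX] at h
  have h1 : ∀ s : Spec A, s 1 = 1 := fun s => map_one s
  simp only [h1, integral_const, Complex.real_smul, mul_one] at h
  refine ⟨?_⟩
  have h2 : β.real univ = 1 := by exact_mod_cast h.symm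
  rw [Measure.real, ENNReal.toReal_eq_one_iff] at h2
  exact h2

theorem tendsto_setIntegral_norm_rpow [BorelSpace X] [IsClosed (A : Set (X →ᵇ ℂ))]
    (hX : IsHomogenizer E lam) (hA : IsHomogenizationAlgebra E lam A)
    {β : Measure (Spec A)} (hβ : IsMMeasure E lam A β) [SFinite lam] [SFinite β] 
    {Ω : Set X} (hΩ : MeasurableSet Ω) {ε : ℕ → E}
    (hε : Tendsto ε atTop (toTheta E)) (a : A) {r : ℝ} (hr : 0 ≤ r) {S : Set X}
    (hS : MeasurableSet S) (hSlam : lam.restrict Ω S < ∞) :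
    Tendsto (fun n => ∫ x in S, ‖pointEval A (ε n • x) a‖ ^ r ∂lam.restrict Ω) atTop
      (𝓝 (∫ z in Prod.fst ⁻¹' S, ‖z.2 a‖ ^ r ∂(lam.restrict Ω).prod β)) := by
  obtain ⟨b, hb⟩ := exists_norm_rpow a hr
  have hf : Integrable ((S ∩ Ω).indicator fun _ => (1 : ℂ)) lam := by
    rw [Measure.restrict_apply hS] at hSlam
    exact (integrable_indicator_iff (hS.inter hΩ)).2 (integrableOn_const hSlam.ne)
  have hlim := (hA.hasMeanValue hX b _ hf).comp hε
  have hl : ∀ n, ∫ x, (b : X →ᵇ ℂ) (ε n • x) * (S ∩ Ω).indicator (fun _ => (1 : ℂ)) x ∂lam =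
      ((∫ x in S, ‖pointEval A (ε n • x) a‖ ^ r ∂lam.restrict Ω : ℝ) : ℂ) := fun n => by
    rw [Measure.restrict_restrict hS, ← integral_complex_ofReal,
      ← integral_indicator (hS.inter hΩ)]
    refine integral_congr_ae (ae_of_all _ fun x => ?_)
    by_cases hx : x ∈ S ∩ Ω
    · simp only [indicator_of_mem hx, mul_one]
      rw [← hb, pointEval_apply]
    · simp [indicator_of_notMem hx]
  have hr : ∫ x, meanValue E lam (b : X →ᵇ ℂ) * (S ∩ Ω).indicator (fun _ => (1 : ℂ)) x ∂lam =
      ((∫ z in Prod.fst ⁻¹' S, ‖z.2 a‖ ^ r ∂(lam.restrict Ω).prod β : ℝ) : ℂ) := by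
    have hS' : (Prod.fst ⁻¹' S : Set (X × Spec A)) = S ×ˢ univ := by ext; simp
    have hp := setIntegral_prod_mul (μ := lam.restrict Ω) (ν := β) (fun _ : X => (1 : ℝ))
      (fun s : Spec A => ‖s a‖ ^ r) S univ
    simp only [one_mul, Measure.restrict_univ] at hp
    rw [hS', hp, integral_const_mul, hβ.2 b, integral_indicator_const _ (hS.inter hΩ)]
    simp_rw [hb]
    rw [integral_complex_ofReal, Complex.ofReal_mul, mul_comm]
    simp [Measure.real, Measure.restrict_apply hS]
  rw [hr] at hlim
  exact (Complex.continuous_re.tendsto _).comp hlim |>.congr fun n => by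
    simp only [Function.comp]; rw [hl, Complex.ofReal_re]

end Homogenizer

end SigmaConvergence

theorem theorem6p1 {E : Set ℝ} [CommGroup E] {X : Type*} [TopologicalSpace X]
    [TopologicalSpace.MetrizableSpace X] [MeasurableSpace X] [BorelSpace X] [MulAction E X]
    {lam : MeasureTheory.Measure X} (hX : SigmaConvergence.IsHomogenizer E lam)
    {A : StarSubalgebra ℂ (X →ᵇ ℂ)} (hA : SigmaConvergence.IsHomogenizationAlgebra E lam A)
    {Ω : Set X} (hΩ : IsOpen Ω) (hΩne : Ω.Nonempty)
    {p : ℝ≥0∞} (hp : 1 < p) (hp_top : p < ∞)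
    (ε : ℕ → E) (hε : SigmaConvergence.IsFundamentalSequence ε)
    (u : ℕ → MeasureTheory.Lp ℂ p (lam.restrict Ω)) (hu : ∃ C : ℝ, ∀ n, ‖u n‖ ≤ C) :
    ∃ φ : ℕ → ℕ, StrictMono φ ∧
      ∃ u₀ : MeasureTheory.Lp ℂ p
          ((lam.restrict Ω).prod (SigmaConvergence.mMeasure hX hA)),
        SigmaConvergence.WeaklySigmaConverges hX hA Ω p (ε ∘ φ) (u ∘ φ) u₀ := by
  open SigmaConvergence in
  obtain ⟨C, hC⟩ := hu
  have := hA.isClosed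
  have := hA.separable
  have := hX.regular
  have := hX.continuous_action
  have := hX.sigmaCompactSpace hε.2
  let _ := TopologicalSpace.metrizableSpaceMetric X
  have : SecondCountableTopology X := EMetric.secondCountable_of_sigmaCompact X
  have : SecondCountableTopology A := UniformSpace.secondCountable_of_separable A
  have hβ := mMeasure_spec hX hA
  have := isProbabilityMeasure_of_isMMeasure hX hβ
  have : Fact (1 ≤ p) := ⟨hp.le⟩
  have hq : p.conjExponent ≠ ∞ := by
    simpa [ENNReal.conjExponent, tsub_eq_zero_iff_le] using hp
  have : Fact (1 ≤ p.conjExponent) := ⟨le_self_add⟩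
  have : Fact (p.conjExponent ≠ ∞) := ⟨hq⟩
  obtain ⟨φ, hφ, u₀, h⟩ := exists_subseq_tendsto_integral_evaluation hp_top.ne hq
    (fun n => isEvaluation_spec (A := A) (σ := fun x => pointEval A (ε n • x)) fun a =>
      ((a : X →ᵇ ℂ).continuous.comp (continuous_const_smul (ε n))).measurable)
    (isEvaluation_spec (σ := fun z : X × Spec A => z.2) fun a =>
      (continuous_spec_apply a).measurable.comp measurable_snd)
    (measurePreserving_fst (μ := lam.restrict Ω) (ν := mMeasure hX hA))
    (tendsto_norm_evalLp hq _ _ _ fun a S hS hSlam =>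
      tendsto_setIntegral_norm_rpow hX hA hβ hΩ.measurableSet hε.2 a ENNReal.toReal_nonneg hS hSlam)
    u C hC
  exact ⟨φ, hφ, u₀, h⟩
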